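/- Let $N\in\mathbb N$, let $H$ be a separable complex Hilbert space, and for every $x\in\mathbb R^N$ let $P_x$ be the orthogonal projection of $H$ onto a closed subspace $G_x\subseteq H$. Assume that $x\mapsto P_x$ is of class $H^1_{\mathrm{loc}}(\mathbb R^N;\mathcal L(H))$, i.e. that it and its weak (Bochner) partial derivatives $\partial_iP$ are locally square integrable with values in $\mathcal L(H)$ (operator norm). Write $\nabla P_x:H\to H^N$, $h\mapsto((\partial_1P)(x)h,\dots,(\partial_NP)(x)h)$, and, for $T\in\mathcal L(H)$, write $d(T)$ for the operator $(h_1,\dots,h_N)\mapsto(Th_1,\dots,Th_N)$ on $H^N$. Let $\mathcal P_{\mathcal G}$ be the orthogonal projection of $L^2(\mathbb R^N;H)$ onto the closed subspace $\mathcal G=\{f\in L^2(\mathbb R^N;H): f(x)\in G_x\text{ for a.e. }x\in\mathbb R^N\}$. Let $a$ be the quadratic form of the Laplacian, $$a(f)=\int_{\mathbb R^N}\|\nabla f(x)\|_{H^N}^2\,dx\quad\text{for }f\in H^1(\mathbb R^N;H),\qquad a(f)=+\infty\quad\text{for }f\in L^2(\mathbb R^N;H)\setminus H^1(\mathbb R^N;H).$$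 Then for all $s\in\mathbb R$ and all $f\in H^1(\mathbb R^N;H)$, as an identity in $[0,+\infty]$, $$a\bigl(e^{is\mathcal P_{\mathcal G}}f\bigr)=\int_{\mathbb R^N}\bigl\|(e^{is}-1)\,e^{-is\,d(P_x)}(\nabla P_x)f(x)+(\nabla f)(x)\bigr\|_{H^N}^2\,dx .$$ In other words, $a(e^{is\mathcal P_{\mathcal G}}f)$ is the integral of $\|\nabla_sf\|^2_{H^N}$ for the covariant derivative $\nabla_sf:=\nabla f+(e^{is}-1)e^{-is\,d(P_\cdot)}(\nabla P_\cdot)f$ with $s$-dependent gauge field $(e^{is}-1)e^{-is\,d(P_\cdot)}\nabla P_\cdot$. In particular, $e^{is\mathcal P_{\mathcal G}}f\in H^1(\mathbb R^N;H)$ if and only if the right-hand side is finite. -/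

import Mathlib

open MeasureTheory
open scoped ContDiff ENNReal

noncomputable section

/-- `L²(ℝ^N; H)`. -/
abbrev L2Space (N : ℕ) (H : Type*) [NormedAddCommGroup H] [InnerProductSpace ℂ H] : Type _ :=
  Lp H 2 (volume : Measure (EuclideanSpace ℝ (Fin N)))

/-- `v` is the `i`-th weak (distributional) partial derivative of `u` on `ℝ^N`; both functions take
values in a Banach space, are locally Bochner integrable, and
`∫ (∂ᵢφ) u = - ∫ φ v` for every scalar test function `φ`. -/
def HasWeakPartialDeriv {N : ℕ} {F : Type*} [NormedAddCommGroup F] [NormedSpace ℝ F]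
    (i : Fin N) (u v : EuclideanSpace ℝ (Fin N) → F) : Prop :=
  LocallyIntegrable u volume ∧ LocallyIntegrable v volume ∧
    ∀ φ : EuclideanSpace ℝ (Fin N) → ℝ, ContDiff ℝ ∞ φ → HasCompactSupport φ →
      ∫ x, fderiv ℝ φ x (EuclideanSpace.single i 1) • u x = - ∫ x, φ x • v x

open Classical in
/-- The `i`-th weak partial derivative of `u` (unique up to null sets), `0` if there is none. -/
def weakPartialDeriv {N : ℕ} {F : Type*} [NormedAddCommGroup F] [NormedSpace ℝ F]
    (i : Fin N) (u : EuclideanSpace ℝ (Fin N) → F) : EuclideanSpace ℝ (Fin N) → F :=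
  if h : ∃ v, HasWeakPartialDeriv i u v then h.choose else 0

/-- `u ∈ H¹(ℝ^N; F)`. -/
def MemH1 {N : ℕ} {F : Type*} [NormedAddCommGroup F] [NormedSpace ℝ F]
    (u : EuclideanSpace ℝ (Fin N) → F) : Prop :=
  MemLp u 2 volume ∧ ∀ i, ∃ v, HasWeakPartialDeriv i u v ∧ MemLp v 2 volume

/-- `u ∈ H¹_loc(ℝ^N; F)`. -/
def MemH1Loc {N : ℕ} {F : Type*} [NormedAddCommGroup F] [NormedSpace ℝ F]
    (u : EuclideanSpace ℝ (Fin N) → F) : Prop :=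
  (∀ K, IsCompact K → MemLp u 2 (volume.restrict K)) ∧
    ∀ i, ∃ v, HasWeakPartialDeriv i u v ∧ ∀ K, IsCompact K → MemLp v 2 (volume.restrict K)

/-- The exponential `e^T = ∑ Tⁿ / n!` of a bounded operator. -/
def opExp {K : Type*} [NormedAddCommGroup K] [InnerProductSpace ℂ K] (T : K →L[ℂ] K) :
    K →L[ℂ] K :=
  NormedSpace.exp T

section Hilbert

variable {N : ℕ} {H : Type*} [NormedAddCommGroup H] [InnerProductSpace ℂ H]

/-- The weak gradient `∇f`, with values in the Hilbert space `H^N`. -/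
def weakGradient (f : EuclideanSpace ℝ (Fin N) → H) (x : EuclideanSpace ℝ (Fin N)) :
    PiLp 2 (fun _ : Fin N => H) :=
  WithLp.toLp 2 fun i => weakPartialDeriv i f x

open Classical in
/-- The quadratic form `a(f) = ∫ ‖∇f(x)‖² dx` of the Laplacian, with form domain `H¹(ℝ^N; H)`; as
usual, it is `+∞` off its domain. -/
def dirichletForm (f : L2Space N H) : ℝ≥0∞ :=
  if MemH1 (f : EuclideanSpace ℝ (Fin N) → H) then ∫⁻ x, ‖weakGradient f x‖ₑ ^ 2 else ∞

/-- The diagonal operator `d(T)` on `H^N` all of whose diagonal entries are `T`. -/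
def diagOp (N : ℕ) (T : H →L[ℂ] H) :
    PiLp 2 (fun _ : Fin N => H) →L[ℂ] PiLp 2 (fun _ : Fin N => H) :=
  (PiLp.continuousLinearEquiv 2 ℂ (fun _ : Fin N => H)).symm.toContinuousLinearMap ∘L
    ContinuousLinearMap.pi fun i => T ∘L PiLp.proj 2 (fun _ : Fin N => H) i

/-- The weak gradient `∇P_x : H → H^N` of an operator-valued function `P`,
`(∇P_x) h = ((∂₁P)(x) h, …, (∂_N P)(x) h)`. -/
def weakGradientOp (P : EuclideanSpace ℝ (Fin N) → H →L[ℂ] H) (x : EuclideanSpace ℝ (Fin N)) :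
    H →L[ℂ] PiLp 2 (fun _ : Fin N => H) :=
  (PiLp.continuousLinearEquiv 2 ℂ (fun _ : Fin N => H)).symm.toContinuousLinearMap ∘L
    ContinuousLinearMap.pi fun i => weakPartialDeriv i P x

/-- The gauge field `(e^{is} - 1) e^{-is d(P_x)} ∇P_x : H → H^N`. -/
def gaugeField (P : EuclideanSpace ℝ (Fin N) → H →L[ℂ] H) (s : ℝ)
    (x : EuclideanSpace ℝ (Fin N)) : H →L[ℂ] PiLp 2 (fun _ : Fin N => H) :=
  (Complex.exp (Complex.I * s) - 1) •
    (opExp ((-(Complex.I * s)) • diagOp N (P x)) ∘L weakGradientOp P x)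

/-- The closed subspace `{f ∈ L²(ℝ^N; H) : f(x) ∈ G_x for a.e. x}`. -/
def fiberwiseSubspace (G : EuclideanSpace ℝ (Fin N) → ClosedSubmodule ℂ H) :
    ClosedSubmodule ℂ (L2Space N H) where
  carrier := {f | ∀ᵐ x, f x ∈ G x}
  add_mem' {f g} hf hg := by
    filter_upwards [hf, hg, Lp.coeFn_add f g] with x h1 h2 h3
    rw [h3]
    exact add_mem h1 h2
  zero_mem' := by
    filter_upwards [Lp.coeFn_zero H 2 (volume : Measure (EuclideanSpace ℝ (Fin N)))] with x h
    rw [h]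
    exact zero_mem _
  smul_mem' c f hf := by
    filter_upwards [hf, Lp.coeFn_smul c f] with x h1 h2
    rw [h2]
    exact (G x).smul_mem c h1
  isClosed' := by
    refine IsSeqClosed.isClosed fun u f hu hf => ?_
    obtain ⟨ns, -, hns⟩ := (tendstoInMeasure_of_tendsto_Lp hf).exists_seq_tendsto_ae
    have hall : ∀ᵐ x, ∀ n, u n x ∈ G x := ae_all_iff.2 hu
    filter_upwards [hns, hall] with x h1 h2
    exact (G x).isClosed'.mem_of_tendsto h1 (Filter.Eventually.of_forall fun k => h2 (ns k))

variable [CompleteSpace H]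

/-- The projection field `x ↦ P_x`, `P_x` being the orthogonal projection of `H` onto `G_x`. -/
def projField (G : EuclideanSpace ℝ (Fin N) → ClosedSubmodule ℂ H)
    (x : EuclideanSpace ℝ (Fin N)) : H →L[ℂ] H :=
  (G x).toSubmodule.starProjection

/-- The orthogonal projection of `L²(ℝ^N; H)` onto `{f : f(x) ∈ G_x for a.e. x}`. -/
def fiberwiseProj (G : EuclideanSpace ℝ (Fin N) → ClosedSubmodule ℂ H) :
    L2Space N H →L[ℂ] L2Space N H :=
  (fiberwiseSubspace G).toSubmodule.starProjection

end Hilbert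

end

/-! A projection satisfies `e^{isP} = 1 + (e^{is} - 1)P`, and the projection onto the fibrewise
subspace acts pointwise by `P_x`, so `g = e^{isP} f` is `f + c P f` with `c = e^{is} - 1`. The weak
product rule `HasWeakPartialDeriv.clm_apply` gives `∂ᵢg = ∂ᵢf + c((∂ᵢP)f + P ∂ᵢf)`. This is the
unitary `e^{isP_x}` applied to the `i`-th component of the covariant derivative, so the norms agree
(`norm_gaugeField_component`).

The product rule is the hard part, as both factors are only weakly differentiable. One factor is
shifted by `z`; the identity is tested in `z` against smooth bumps, where Fubini moves the mollifier
onto either factor, and continuity in `z` allows evaluation at `z = 0`. -/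

theorem memLp_smul_of_hasCompactSupport {X V : Type*} [TopologicalSpace X] [MeasurableSpace X]
    [OpensMeasurableSpace X] [NormedAddCommGroup V] [NormedSpace ℝ V] {μ : Measure X} {p : ℝ≥0∞}
    {ψ : X → ℝ} {u : X → V} (hψ : Continuous ψ) (hψc : HasCompactSupport ψ)
    (hu : ∀ K, IsCompact K → MemLp u p (μ.restrict K)) : MemLp (fun x => ψ x • u x) p μ := by
  obtain ⟨C, hC⟩ := hψ.bounded_above_of_compact_support hψc
  have h1 : MemLp (fun x => ψ x • u x) p (μ.restrict (tsupport ψ)) := by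
    refine ((hu _ hψc.isCompact).norm.const_mul C).mono
      (hψ.aestronglyMeasurable.smul (hu _ hψc.isCompact).aestronglyMeasurable)
      (Filter.Eventually.of_forall fun x => ?_)
    rw [norm_smul, norm_mul, norm_norm]
    exact mul_le_mul_of_nonneg_right ((hC x).trans (le_abs_self C)) (norm_nonneg _)
  convert (memLp_indicator_iff_restrict (isClosed_tsupport ψ).measurableSet).2 h1 using 1
  ext1 x
  by_cases hx : x ∈ tsupport ψ
  · rw [Set.indicator_of_mem hx]
  · rw [Set.indicator_of_notMem hx, image_eq_zero_of_notMem_tsupport hx, zero_smul]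

/-! ### Weak product rule for operator fields acting on vector fields. -/

section ProductRule

variable {N : ℕ} {E F : Type*} [NormedAddCommGroup E] [NormedSpace ℂ E]
  [NormedAddCommGroup F] [NormedSpace ℂ F]

open scoped Pointwise in
/-- The integrand `ρ(y - x) A(x) f(y)` of a regularised pairing is integrable on the product space. -/
theorem integrable_prod_bump_smul_apply {ρ : EuclideanSpace ℝ (Fin N) → ℝ} (hρ : Continuous ρ)
    (hρc : HasCompactSupport ρ) {A : EuclideanSpace ℝ (Fin N) → E →L[ℂ] F} (hA : Integrable A)
    (hAc : HasCompactSupport A) {f : EuclideanSpace ℝ (Fin N) → E} (hf : LocallyIntegrable f) :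
    Integrable (fun p : EuclideanSpace ℝ (Fin N) × EuclideanSpace ℝ (Fin N) =>
      ρ (p.2 - p.1) • A p.1 (f p.2)) (volume.prod volume) := by
  obtain ⟨C, hC⟩ := hρ.bounded_above_of_compact_support hρc
  set K := tsupport A + tsupport ρ with hK
  -- If `A x ≠ 0` and `ρ (y - x) ≠ 0`, then `y` lies in this Minkowski sum, so only `f` on a compact
  -- set matters.
  have hKc : IsCompact K := hAc.isCompact.add hρc.isCompact
  have hfK : Integrable (K.indicator f) :=
    (integrable_indicator_iff hKc.measurableSet).2 (hf.integrableOn_isCompact hKc)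
  refine Integrable.mono' ((hA.norm.mul_prod hfK.norm).const_mul C) ?_ ?_
  · have hm : AEStronglyMeasurable (fun p : EuclideanSpace ℝ (Fin N) × EuclideanSpace ℝ (Fin N) =>
        ρ (p.2 - p.1)) (volume.prod volume) :=
      (hρ.comp (continuous_snd.sub continuous_fst)).aestronglyMeasurable
    refine hm.smul (𝕜 := ℝ) ?_
    exact (ContinuousLinearMap.id ℂ (E →L[ℂ] F)).aestronglyMeasurable_comp₂
      hA.aestronglyMeasurable.comp_fst hf.aestronglyMeasurable.comp_snd
  · refine Filter.Eventually.of_forall fun p => ?_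
    rw [norm_smul]
    have h0 : 0 ≤ C := (norm_nonneg _).trans (hC 0)
    by_cases hp : p.2 ∈ K
    · rw [Set.indicator_of_mem hp]
      exact mul_le_mul (hC _) ((A p.1).le_opNorm _) (norm_nonneg _) h0
    · have : ρ (p.2 - p.1) = 0 ∨ A p.1 = 0 := by
        by_contra! h
        refine hp ⟨p.1, subset_tsupport _ h.2, p.2 - p.1, subset_tsupport _ h.1, by simp⟩
      have hz : ρ (p.2 - p.1) • A p.1 (f p.2) = 0 := by
        rcases this with h | h <;> simp [h]
      rw [← norm_smul, hz, norm_zero]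
      positivity

/-- Fubini and the substitution `y = z + x`. The next lemmas let the mollifier fall on `A` or on
`f`. -/
theorem integral_bump_smul_translate_eq {ρ : EuclideanSpace ℝ (Fin N) → ℝ} (hρ : Continuous ρ)
    (hρc : HasCompactSupport ρ) {A : EuclideanSpace ℝ (Fin N) → E →L[ℂ] F} (hA : Integrable A)
    (hAc : HasCompactSupport A) {f : EuclideanSpace ℝ (Fin N) → E} (hf : LocallyIntegrable f) :
    ∫ z, ρ z • ∫ x, A x (f (z + x)) = ∫ x, ∫ y, ρ (y - x) • A x (f y) := by
  have hint := integrable_prod_bump_smul_apply hρ hρc hA hAc hf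
  have h1 : Integrable (fun p : EuclideanSpace ℝ (Fin N) × EuclideanSpace ℝ (Fin N) =>
      ρ p.2 • A p.1 (f (p.2 + p.1))) (volume.prod volume) := by
    have := (measurePreserving_prod_add (volume : Measure (EuclideanSpace ℝ (Fin N)))
      (volume : Measure (EuclideanSpace ℝ (Fin N)))).integrable_comp_of_integrable hint
    refine this.congr (Filter.Eventually.of_forall fun p => ?_)
    simp [add_comm]
  calc ∫ z, ρ z • ∫ x, A x (f (z + x)) = ∫ z, ∫ x, ρ z • A x (f (z + x)) := by
        simp_rw [integral_smul]
    _ = ∫ x, ∫ z, ρ z • A x (f (z + x)) := (integral_integral_swap h1).symm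
    _ = _ := by
        refine integral_congr_ae (Filter.Eventually.of_forall fun x => ?_)
        have := integral_add_right_eq_self (μ := (volume : Measure (EuclideanSpace ℝ (Fin N))))
          (fun y => ρ (y - x) • A x (f y)) x
        simpa using this

theorem integral_bump_smul_apply {ρ : EuclideanSpace ℝ (Fin N) → ℝ} (hρ : Continuous ρ)
    (hρc : HasCompactSupport ρ) {A : EuclideanSpace ℝ (Fin N) → E →L[ℂ] F} (hA : Integrable A)
    (y : EuclideanSpace ℝ (Fin N)) (h : E) :
    ∫ x, ρ (y - x) • A x h = (∫ x, ρ (y - x) • A x) h := by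
  obtain ⟨C, hC⟩ := hρ.bounded_above_of_compact_support hρc
  have hi : Integrable fun x => ρ (y - x) • A x :=
    hA.bdd_smul C (hρ.comp (continuous_const.sub continuous_id)).aestronglyMeasurable
      (Filter.Eventually.of_forall fun x => hC _)
  exact (ContinuousLinearMap.integral_apply hi h).symm

theorem integral_bump_smul_translate_eq_left {ρ : EuclideanSpace ℝ (Fin N) → ℝ} (hρ : Continuous ρ)
    (hρc : HasCompactSupport ρ) {A : EuclideanSpace ℝ (Fin N) → E →L[ℂ] F} (hA : Integrable A)
    (hAc : HasCompactSupport A) {f : EuclideanSpace ℝ (Fin N) → E} (hf : LocallyIntegrable f) :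
    ∫ z, ρ z • ∫ x, A x (f (z + x)) = ∫ y, (∫ x, ρ (y - x) • A x) (f y) := by
  rw [integral_bump_smul_translate_eq hρ hρc hA hAc hf,
    integral_integral_swap (integrable_prod_bump_smul_apply hρ hρc hA hAc hf)]
  simp_rw [integral_bump_smul_apply hρ hρc hA]

variable [CompleteSpace E] [CompleteSpace F]

theorem integral_bump_smul_translate_eq_right {ρ : EuclideanSpace ℝ (Fin N) → ℝ} (hρ : Continuous ρ)
    (hρc : HasCompactSupport ρ) {A : EuclideanSpace ℝ (Fin N) → E →L[ℂ] F} (hA : Integrable A)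
    (hAc : HasCompactSupport A) {f : EuclideanSpace ℝ (Fin N) → E} (hf : LocallyIntegrable f) :
    ∫ z, ρ z • ∫ x, A x (f (z + x)) = ∫ x, A x (∫ y, ρ (y - x) • f y) := by
  rw [integral_bump_smul_translate_eq hρ hρc hA hAc hf]
  refine integral_congr_ae (Filter.Eventually.of_forall fun x => ?_)
  have hi : Integrable fun y => ρ (y - x) • f y := by
    refine hf.integrable_smul_left_of_hasCompactSupport
      (hρ.comp (continuous_id.sub continuous_const)) ?_
    exact hρc.comp_homeomorph (Homeomorph.subRight x)
  have := (A x).integral_comp_comm hi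
  beta_reduce
  rw [← this]
  simp only [(A x).map_smul_of_tower]

omit [CompleteSpace E] in
-- Translation is strongly continuous on `L²`, and the pairing is bounded.
theorem continuous_integral_apply_translate {A : EuclideanSpace ℝ (Fin N) → E →L[ℂ] F}
    (hA : MemLp A 2 volume) {f : EuclideanSpace ℝ (Fin N) → E} (hf : MemLp f 2 volume) :
    Continuous fun z => ∫ x, A x (f (z + x)) := by
  have hc : Continuous fun z : EuclideanSpace ℝ (Fin N) =>
      (ContinuousLinearMap.id ℂ (E →L[ℂ] F)).lpPairing volume 2 2 (hA.toLp A)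
        (DomAddAct.mk z +ᵥ hf.toLp f) := by
    refine (ContinuousLinearMap.continuous _).comp ?_
    have : Fact ((2 : ℝ≥0∞) ≠ ⊤) := ⟨by simp⟩
    exact (DomAddAct.continuous_mk).vadd continuous_const
  convert hc using 2 with z
  rw [ContinuousLinearMap.lpPairing_eq_integral]
  refine integral_congr_ae ?_
  filter_upwards [hA.coeFn_toLp, (DomAddAct.vadd_Lp_ae_eq (DomAddAct.mk z) (hf.toLp f)),
    (measurePreserving_add_left volume z).quasiMeasurePreserving.ae_eq_comp hf.coeFn_toLp]
    with x h1 h2 h3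
  simp only [Function.comp] at h3
  rw [h1, h2]
  simp [h3]

set_option maxHeartbeats 1000000 in
/-- The product rule for weak derivatives of an operator field applied to a vector field. -/
theorem HasWeakPartialDeriv.clm_apply {i : Fin N}
    {A A' : EuclideanSpace ℝ (Fin N) → E →L[ℂ] F} {f f' : EuclideanSpace ℝ (Fin N) → E}
    (hA : HasWeakPartialDeriv i A A') (hf : HasWeakPartialDeriv i f f')
    (hA2 : ∀ K, IsCompact K → MemLp A 2 (volume.restrict K))
    (hA2' : ∀ K, IsCompact K → MemLp A' 2 (volume.restrict K))
    (hf2 : MemLp f 2 volume) (hf2' : MemLp f' 2 volume) :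
    HasWeakPartialDeriv i (fun x => A x (f x)) (fun x => A' x (f x) + A x (f' x)) := by
  have key : ∀ (B : EuclideanSpace ℝ (Fin N) → E →L[ℂ] F) (g : EuclideanSpace ℝ (Fin N) → E),
      (∀ K, IsCompact K → MemLp B 2 (volume.restrict K)) → MemLp g 2 volume →
      LocallyIntegrable (fun x => B x (g x)) volume := by
    intro B g hB hg
    refine locallyIntegrable_iff.2 fun K hK => ?_
    exact memLp_one_iff_integrable.1
      ((ContinuousLinearMap.id ℂ (E →L[ℂ] F)).memLp_of_bilin 1 (hB K hK) (hg.restrict K))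
  have hloc := key A' f hA2' hf2
  have hloc' := key A f' hA2 hf2'
  refine ⟨key A f hA2 hf2, hloc.add hloc', fun φ hφ hφc => ?_⟩
  set e : EuclideanSpace ℝ (Fin N) := EuclideanSpace.single i 1 with he
  set dφ : EuclideanSpace ℝ (Fin N) → ℝ := fun x => fderiv ℝ φ x e with hdφ
  have hdφ_cont : Continuous dφ := (hφ.continuous_fderiv (by simp)).clm_apply continuous_const
  have hdφc : HasCompactSupport dφ := hφc.fderiv_apply ℝ e
  have m1 := memLp_smul_of_hasCompactSupport hdφ_cont hdφc hA2
  have m2 := memLp_smul_of_hasCompactSupport hφ.continuous hφc hA2'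
  have m3 := memLp_smul_of_hasCompactSupport hφ.continuous hφc hA2
  have i1 : Integrable fun x => dφ x • A x :=
    hA.1.integrable_smul_left_of_hasCompactSupport hdφ_cont hdφc
  have i2 : Integrable fun x => φ x • A' x :=
    hA.2.1.integrable_smul_left_of_hasCompactSupport hφ.continuous hφc
  have i3 : Integrable fun x => φ x • A x :=
    hA.1.integrable_smul_left_of_hasCompactSupport hφ.continuous hφc
  have c1 : HasCompactSupport fun x => dφ x • A x := hdφc.smul_right
  have c2 : HasCompactSupport fun x => φ x • A' x := hφc.smul_right
  have c3 : HasCompactSupport fun x => φ x • A x := hφc.smul_right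
  have t1 := continuous_integral_apply_translate m1 hf2
  have t2 := continuous_integral_apply_translate m2 hf2
  have t3 := continuous_integral_apply_translate m3 hf2'
  -- At `z = 0` the bracket is the product rule tested against `φ`.
  have hzero : ∀ ρ : EuclideanSpace ℝ (Fin N) → ℝ, ContDiff ℝ ∞ ρ → HasCompactSupport ρ →
      ∫ z, ρ z • ((∫ x, (dφ x • A x) (f (z + x))) + (∫ x, (φ x • A' x) (f (z + x))) +
        ∫ x, (φ x • A x) (f' (z + x))) = 0 := by
    intro ρ hρ hρc
    set dρ : EuclideanSpace ℝ (Fin N) → ℝ := fun x => fderiv ℝ ρ x e with hdρ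
    have hdρ_cont : Continuous dρ := (hρ.continuous_fderiv (by simp)).clm_apply continuous_const
    have hdρc : HasCompactSupport dρ := hρc.fderiv_apply ℝ e
    have it : ∀ T : EuclideanSpace ℝ (Fin N) → F, Continuous T →
        Integrable fun z => ρ z • T z := fun T hT =>
      (hρ.continuous.smul hT).integrable_of_hasCompactSupport hρc.smul_right
    have e1 := integral_bump_smul_translate_eq_left hρ.continuous hρc i1 c1 hf.1
    have e2 := integral_bump_smul_translate_eq_left hρ.continuous hρc i2 c2 hf.1
    have e3 := integral_bump_smul_translate_eq_right hρ.continuous hρc i3 c3 hf.2.1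
    have e4 := integral_bump_smul_translate_eq_left hdρ_cont hdρc i3 c3 hf.1
    have e5 := integral_bump_smul_translate_eq_right hdρ_cont hdρc i3 c3 hf.1
    have test_f : ∀ x, ∫ y, dρ (y - x) • f y = - ∫ y, ρ (y - x) • f' y := by
      intro x
      have := hf.2.2 (fun y => ρ (y - x)) (hρ.comp (contDiff_id.sub contDiff_const))
        (hρc.comp_homeomorph (Homeomorph.subRight x))
      simpa only [fderiv_comp_sub] using this
    -- The weak derivative of `A` is tested against `x ↦ φ x * ρ (y - x)`; the reflection produces
    -- the sign in front of `dρ`.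
    have test_A : ∀ y, (∫ x, ρ (y - x) • dφ x • A x) + (∫ x, ρ (y - x) • φ x • A' x) =
        ∫ x, dρ (y - x) • φ x • A x := by
      intro y
      have hρy : ContDiff ℝ ∞ fun x => ρ (y - x) := hρ.comp (contDiff_const.sub contDiff_id)
      have hd : ∀ x, fderiv ℝ (fun x => φ x * ρ (y - x)) x e =
          ρ (y - x) * dφ x - dρ (y - x) * φ x := by
        intro x
        have h1 : HasFDerivAt φ (fderiv ℝ φ x) x :=
          (hφ.differentiable (by simp) x).hasFDerivAt
        have h2 : HasFDerivAt (fun x => ρ (y - x))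
            ((fderiv ℝ ρ (y - x)).comp (-ContinuousLinearMap.id ℝ _)) x :=
          ((hρ.differentiable (by simp) (y - x)).hasFDerivAt).comp x
            ((hasFDerivAt_id x).const_sub y)
        have h3 : HasFDerivAt (fun x => φ x * ρ (y - x)) _ x := h1.mul h2
        rw [h3.fderiv]
        simp [hdφ, hdρ]
        ring
      have ht := hA.2.2 (fun x => φ x * ρ (y - x)) (hφ.mul hρy) hφc.mul_right
      have bdd : ∀ (σ : EuclideanSpace ℝ (Fin N) → ℝ) (B : EuclideanSpace ℝ (Fin N) → E →L[ℂ] F),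
          Continuous σ → HasCompactSupport σ → Integrable B →
          Integrable fun x => σ (y - x) • B x := by
        intro σ B hσ hσc hB
        obtain ⟨C, hC⟩ := hσ.bounded_above_of_compact_support hσc
        exact hB.bdd_smul C (hσ.comp (continuous_const.sub continuous_id)).aestronglyMeasurable
          (Filter.Eventually.of_forall fun x => hC _)
      rw [← he] at ht
      simp_rw [hd, sub_smul, mul_smul] at ht
      rw [integral_sub (bdd _ _ hρ.continuous hρc i1) (bdd _ _ hdρ_cont hdρc i3)] at ht
      simp_rw [smul_comm (φ _) (ρ _)] at ht
      rw [sub_eq_iff_eq_add] at ht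
      rw [ht]
      abel
    have e34 : ∫ z, ρ z • ∫ x, (φ x • A x) (f' (z + x)) =
        - ∫ z, dρ z • ∫ x, (φ x • A x) (f (z + x)) := by
      rw [e3, e5, ← integral_neg]
      simp [test_f]
    have int_left : ∀ (σ : EuclideanSpace ℝ (Fin N) → ℝ)
        (B : EuclideanSpace ℝ (Fin N) → E →L[ℂ] F), Continuous σ → HasCompactSupport σ →
        Integrable B → HasCompactSupport B →
        Integrable fun y => (∫ x, σ (y - x) • B x) (f y) := by
      intro σ B hσ hσc hB hBc
      have := (integrable_prod_bump_smul_apply hσ hσc hB hBc hf.1).integral_prod_right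
      simpa only [integral_bump_smul_apply hσ hσc hB] using this
    have it12 : Integrable fun z => ρ z • (∫ x, (dφ x • A x) (f (z + x))) +
        ρ z • (∫ x, (φ x • A' x) (f (z + x))) := (it _ t1).add (it _ t2)
    simp_rw [smul_add]
    rw [integral_add it12 (it _ t3), integral_add (it _ t1) (it _ t2),
      e34, e1, e2, e4, ← sub_eq_add_neg, sub_eq_zero,
      ← integral_add (int_left _ _ hρ.continuous hρc i1 c1) (int_left _ _ hρ.continuous hρc i2 c2)]
    refine integral_congr_ae (Filter.Eventually.of_forall fun y => ?_)
    beta_reduce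
    rw [← test_A, add_apply]
  -- The bracket vanishes for a.e. `z`, hence by continuity for every `z`, in particular at `0`.
  have hae := ae_eq_zero_of_integral_contDiff_smul_eq_zero
    ((t1.add t2).add t3).locallyIntegrable hzero
  have h0 := congrFun (((t1.add t2).add t3).ae_eq_iff_eq volume continuous_zero |>.1 hae) 0
  simp only [Pi.add_apply, zero_add, Pi.zero_apply] at h0
  have h0' : (∫ x, dφ x • A x (f x)) + (∫ x, φ x • A' x (f x)) + ∫ x, φ x • A x (f' x) = 0 := h0
  simp_rw [smul_add]
  rw [integral_add (hloc.integrable_smul_left_of_hasCompactSupport hφ.continuous hφc)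
    (hloc'.integrable_smul_left_of_hasCompactSupport hφ.continuous hφc)]
  rw [← add_eq_zero_iff_eq_neg, ← add_assoc]
  exact h0'

end ProductRule

/-! ### Uniqueness and linearity of weak derivatives. -/

section WeakDerivative

variable {N : ℕ} {F : Type*} [NormedAddCommGroup F] [NormedSpace ℝ F]

theorem HasWeakPartialDeriv.weakPartialDeriv_ae_eq [CompleteSpace F] {i : Fin N}
    {u v : EuclideanSpace ℝ (Fin N) → F} (h : HasWeakPartialDeriv i u v) :
    weakPartialDeriv i u =ᵐ[volume] v := by
  have hex : ∃ w, HasWeakPartialDeriv i u w := ⟨v, h⟩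
  rw [weakPartialDeriv, dif_pos hex]
  refine ae_eq_of_integral_contDiff_smul_eq hex.choose_spec.2.1 h.2.1 fun φ hφ hφc => ?_
  rw [← neg_inj, ← hex.choose_spec.2.2 φ hφ hφc, h.2.2 φ hφ hφc]

theorem HasWeakPartialDeriv.congr {i : Fin N} {u u' v v' : EuclideanSpace ℝ (Fin N) → F}
    (h : HasWeakPartialDeriv i u v) (hu : u =ᵐ[volume] u') (hv : v =ᵐ[volume] v') :
    HasWeakPartialDeriv i u' v' := by
  refine ⟨h.1.congr hu, h.2.1.congr hv, fun φ hφ hφc => ?_⟩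
  have h1 : ∫ x, fderiv ℝ φ x (EuclideanSpace.single i 1) • u x =
      ∫ x, fderiv ℝ φ x (EuclideanSpace.single i 1) • u' x :=
    integral_congr_ae (hu.mono fun x hx => congrArg _ hx)
  have h2 : ∫ x, φ x • v x = ∫ x, φ x • v' x :=
    integral_congr_ae (hv.mono fun x hx => congrArg _ hx)
  rw [← h1, ← h2]
  exact h.2.2 φ hφ hφc

theorem HasWeakPartialDeriv.add {i : Fin N} {u u' v v' : EuclideanSpace ℝ (Fin N) → F}
    (h : HasWeakPartialDeriv i u v) (h' : HasWeakPartialDeriv i u' v') :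
    HasWeakPartialDeriv i (fun x => u x + u' x) (fun x => v x + v' x) := by
  refine ⟨h.1.add h'.1, h.2.1.add h'.2.1, fun φ hφ hφc => ?_⟩
  have hd : Continuous fun x => fderiv ℝ φ x (EuclideanSpace.single i 1) :=
    (hφ.continuous_fderiv (by simp)).clm_apply continuous_const
  have hdc : HasCompactSupport fun x => fderiv ℝ φ x (EuclideanSpace.single i 1) :=
    hφc.fderiv_apply ℝ _
  simp_rw [smul_add]
  rw [integral_add (h.1.integrable_smul_left_of_hasCompactSupport hd hdc)
      (h'.1.integrable_smul_left_of_hasCompactSupport hd hdc),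
    integral_add (h.2.1.integrable_smul_left_of_hasCompactSupport hφ.continuous hφc)
      (h'.2.1.integrable_smul_left_of_hasCompactSupport hφ.continuous hφc),
    h.2.2 φ hφ hφc, h'.2.2 φ hφ hφc, neg_add]

theorem HasWeakPartialDeriv.const_smul {E : Type*} [NormedAddCommGroup E] [NormedSpace ℂ E]
    {i : Fin N} {u v : EuclideanSpace ℝ (Fin N) → E} (h : HasWeakPartialDeriv i u v) (c : ℂ) :
    HasWeakPartialDeriv i (fun x => c • u x) (fun x => c • v x) := by
  refine ⟨h.1.smul c, h.2.1.smul c, fun φ hφ hφc => ?_⟩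
  simp_rw [smul_comm _ c]
  rw [integral_smul, integral_smul, h.2.2 φ hφ hφc, smul_neg]

end WeakDerivative

/-! ### Exponentials of idempotents. -/

section Exponential

variable {K : Type*} [NormedAddCommGroup K] [InnerProductSpace ℂ K] [CompleteSpace K]

/-- The exponential of a multiple of an idempotent operator. -/
theorem opExp_smul_of_isIdempotentElem {Q : K →L[ℂ] K} (hQ : IsIdempotentElem Q) (z : ℂ) :
    opExp (z • Q) = 1 + (Complex.exp z - 1) • Q := by
  have h1 := NormedSpace.exp_series_hasSum_exp' (𝕂 := ℂ) (z • Q)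
  have h2 := (NormedSpace.exp_series_hasSum_exp' (𝕂 := ℂ) z).smul_const Q
  rw [← Complex.exp_eq_exp_ℂ] at h2
  -- `(z • Q) ^ n = z ^ n • Q` fails only at `n = 0`, where the power is `1`; the extra term `1 - Q`
  -- corrects this.
  have h3 := h2.add (hasSum_ite_eq (0 : ℕ) (1 - Q))
  have h4 : HasSum (fun n : ℕ => (n.factorial⁻¹ : ℂ) • (z • Q) ^ n)
      (Complex.exp z • Q + (1 - Q)) := by
    convert h3 using 1
    ext1 n
    rcases n with _ | n
    · simp
    · simp [smul_pow, hQ.pow_succ_eq, smul_smul]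
  rw [opExp, h1.unique h4, sub_smul, one_smul]
  abel

end Exponential

/-! ### Fibrewise projections and the gauge field. -/

section Fiberwise

variable {N : ℕ} {H : Type*} [NormedAddCommGroup H] [InnerProductSpace ℂ H]

theorem diagOp_apply (T : H →L[ℂ] H) (v : PiLp 2 fun _ : Fin N => H) (i : Fin N) :
    diagOp N T v i = T (v i) := rfl

theorem isIdempotentElem_diagOp {T : H →L[ℂ] H} (hT : IsIdempotentElem T) :
    IsIdempotentElem (diagOp N T) := by
  ext v i
  simpa [diagOp_apply] using congrArg (fun S : H →L[ℂ] H => S (v i)) hT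

variable [CompleteSpace H]

theorem isIdempotentElem_projField (G : EuclideanSpace ℝ (Fin N) → ClosedSubmodule ℂ H)
    (x : EuclideanSpace ℝ (Fin N)) : IsIdempotentElem (projField G x) :=
  Submodule.isIdempotentElem_starProjection _

/-- The orthogonal projection onto the fibrewise subspace acts fibrewise. -/
theorem fiberwiseProj_ae_eq (G : EuclideanSpace ℝ (Fin N) → ClosedSubmodule ℂ H)
    (hP : AEStronglyMeasurable (projField G) volume) (f : L2Space N H) :
    fiberwiseProj G f =ᵐ[volume] fun x => projField G x (f x) := by
  have hm : MemLp (fun x => projField G x (f x)) 2 volume := by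
    refine (Lp.memLp f).mono ((ContinuousLinearMap.id ℂ (H →L[ℂ] H)).aestronglyMeasurable_comp₂
      hP (Lp.aestronglyMeasurable f)) (Filter.Eventually.of_forall fun x => ?_)
    exact Submodule.norm_starProjection_apply_le _ _
  have heq : fiberwiseProj G f = hm.toLp _ := by
    refine Submodule.eq_starProjection_of_mem_of_inner_eq_zero ?_ fun w hw => ?_
    · change ∀ᵐ x, hm.toLp _ x ∈ G x
      filter_upwards [hm.coeFn_toLp] with x hx
      rw [hx]
      exact Submodule.starProjection_apply_mem _ _
    · replace hw : ∀ᵐ x, w x ∈ G x := hw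
      rw [L2.inner_def]
      refine integral_eq_zero_of_ae ?_
      filter_upwards [hw, Lp.coeFn_sub f (hm.toLp _), hm.coeFn_toLp] with x h1 h2 h3
      rw [h2, Pi.sub_apply, h3]
      exact Submodule.starProjection_inner_eq_zero _ _ h1
  rw [heq]
  exact hm.coeFn_toLp

/-- The component in `G x` is multiplied by the unimodular `e^{is}`, the orthogonal one is
unchanged; Pythagoras concludes. -/
theorem norm_add_smul_projField (G : EuclideanSpace ℝ (Fin N) → ClosedSubmodule ℂ H) (s : ℝ)
    (x : EuclideanSpace ℝ (Fin N)) (h : H) :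
    ‖h + (Complex.exp (Complex.I * s) - 1) • projField G x h‖ = ‖h‖ := by
  set p := projField G x h with hp
  have horth : inner ℂ (h - p) p = 0 :=
    Submodule.starProjection_inner_eq_zero _ _ (Submodule.starProjection_apply_mem _ _)
  have e1 : h + (Complex.exp (Complex.I * s) - 1) • p =
      (h - p) + Complex.exp (Complex.I * s) • p := by
    rw [sub_smul, one_smul]; abel
  have n1 := norm_add_sq_eq_norm_sq_add_norm_sq_of_inner_eq_zero (𝕜 := ℂ) (h - p) p horth
  have n2 := norm_add_sq_eq_norm_sq_add_norm_sq_of_inner_eq_zero (𝕜 := ℂ) (h - p)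
    (Complex.exp (Complex.I * s) • p) (by rw [inner_smul_right, horth, mul_zero])
  rw [norm_smul, mul_comm Complex.I, Complex.norm_exp_ofReal_mul_I, one_mul] at n2
  rw [sub_add_cancel] at n1
  rw [e1, mul_comm Complex.I]
  rw [← n1] at n2
  exact (mul_self_inj (norm_nonneg _) (norm_nonneg _)).1 n2

/-- Componentwise comparison of the covariant derivative with the derivative of `e^{isP} f`. -/
theorem norm_gaugeField_component (G : EuclideanSpace ℝ (Fin N) → ClosedSubmodule ℂ H) (s : ℝ)
    (x : EuclideanSpace ℝ (Fin N)) (w : PiLp 2 fun _ : Fin N => H) (h : H) (i : Fin N) :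
    ‖(gaugeField (projField G) s x h + w) i‖ =
      ‖w i + (Complex.exp (Complex.I * s) - 1) •
        (weakPartialDeriv i (projField G) x h + projField G x (w i))‖ := by
  set P := projField G x with hP
  set D := weakPartialDeriv i (projField G) x h with hD
  set a := Complex.exp (Complex.I * s) with ha
  have hPP : ∀ k, P (P k) = P k := fun k =>
    congrArg (fun S : H →L[ℂ] H => S k) (isIdempotentElem_projField G x)
  have hab : a * Complex.exp (-(Complex.I * s)) = 1 := by
    rw [ha, ← Complex.exp_add, add_neg_cancel, Complex.exp_zero]
  set b := Complex.exp (-(Complex.I * s)) with hb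
  have hg : (gaugeField (projField G) s x h + w) i =
      (a - 1) • (D + (b - 1) • P D) + w i := by
    rw [gaugeField, opExp_smul_of_isIdempotentElem
      (isIdempotentElem_diagOp (isIdempotentElem_projField G x))]
    rfl
  -- The isometry `e^{isP_x}` is applied inside the left norm; the two vectors then coincide.
  rw [hg, ← norm_add_smul_projField G s x]
  congr 1
  have hPk : projField G x ((a - 1) • (D + (b - 1) • P D) + w i) =
      (a - 1) • (P D + (b - 1) • P D) + P (w i) := by
    rw [← hP, map_add, map_smul, map_add, map_smul, hPP]
  rw [hPk]
  match_scalars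
  · ring
  -- The coefficient of `P D` is `(a - 1)(ab - 1) = 0`.
  · linear_combination (a - 1) * hab
  · ring
  · ring

end Fiberwise

/-! ### From weak derivatives to the form identity. -/

theorem memH1_of_lintegral_weakGradient_ne_top {N : ℕ} {H : Type*} [NormedAddCommGroup H]
    [InnerProductSpace ℂ H] [CompleteSpace H] {u : EuclideanSpace ℝ (Fin N) → H}
    (hu : MemLp u 2 volume) (hd : ∀ i, ∃ v, HasWeakPartialDeriv i u v)
    (hfin : ∫⁻ x, ‖weakGradient u x‖ₑ ^ 2 ≠ ⊤) : MemH1 u := by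
  refine ⟨hu, fun i => ?_⟩
  obtain ⟨v, hv⟩ := hd i
  refine ⟨v, hv, hv.2.1.aestronglyMeasurable, ?_⟩
  rw [eLpNorm_lt_top_iff_lintegral_rpow_enorm_lt_top (by simp) (by simp)]
  refine lt_of_le_of_lt (lintegral_mono_ae ?_) hfin.lt_top
  filter_upwards [hv.weakPartialDeriv_ae_eq] with x hx
  have : ‖v x‖ₑ ≤ ‖weakGradient u x‖ₑ := by
    rw [← hx]
    exact PiLp.enorm_apply_le (weakGradient u x) i
  simpa using pow_le_pow_left' this 2

theorem mainTheorem3 {N : ℕ} {H : Type*} [NormedAddCommGroup H] [InnerProductSpace ℂ H]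
    [CompleteSpace H] [TopologicalSpace.SeparableSpace H]
    (G : EuclideanSpace ℝ (Fin N) → ClosedSubmodule ℂ H)
    (hP : MemH1Loc (projField G))
    (f : L2Space N H) (hf : MemH1 (f : EuclideanSpace ℝ (Fin N) → H)) (s : ℝ) :
    dirichletForm (opExp ((Complex.I * s) • fiberwiseProj G) f) =
      ∫⁻ x, ‖gaugeField (projField G) s x (f x) +
        weakGradient (f : EuclideanSpace ℝ (Fin N) → H) x‖ₑ ^ 2 := by
  set c := Complex.exp (Complex.I * s) - 1 with hc
  have hPm : AEStronglyMeasurable (projField G) volume :=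
    (locallyIntegrable_iff.2 fun K hK => by
      have : IsFiniteMeasure (volume.restrict K) :=
        isFiniteMeasure_restrict.2 hK.measure_lt_top.ne
      exact (hP.1 K hK).integrable (by norm_num)).aestronglyMeasurable
  set g := opExp ((Complex.I * s) • fiberwiseProj G) f with hg
  have hg_ae : g =ᵐ[volume] fun x => f x + c • projField G x (f x) := by
    have : g = f + c • fiberwiseProj G f := by
      have hQ : IsIdempotentElem (fiberwiseProj G) := Submodule.isIdempotentElem_starProjection _
      rw [hg, opExp_smul_of_isIdempotentElem hQ]
      rfl
    rw [this]
    filter_upwards [Lp.coeFn_add f (c • fiberwiseProj G f), Lp.coeFn_smul c (fiberwiseProj G f),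
      fiberwiseProj_ae_eq G hPm f] with x h1 h2 h3
    rw [h1, Pi.add_apply, h2, Pi.smul_apply, h3]
  choose df hdf hdf2 using hf.2
  choose dP hdP hdP2 using hP.2
  -- These derivatives exist in `L¹_loc` whether or not `g` is in `H¹`.
  have hder : ∀ i, HasWeakPartialDeriv i g
      fun x => df i x + c • (dP i x (f x) + projField G x (df i x)) := fun i =>
    ((hdf i).add (((hdP i).clm_apply (hdf i) hP.1 (hdP2 i) hf.1 (hdf2 i)).const_smul c)).congr
      hg_ae.symm Filter.EventuallyEq.rfl
  have hnorm : ∀ᵐ x, ‖weakGradient (g : EuclideanSpace ℝ (Fin N) → H) x‖ₑ =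
      ‖gaugeField (projField G) s x (f x) +
        weakGradient (f : EuclideanSpace ℝ (Fin N) → H) x‖ₑ := by
    have h1 := ae_all_iff.2 fun i => (hder i).weakPartialDeriv_ae_eq
    have h2 := ae_all_iff.2 fun i => (hdf i).weakPartialDeriv_ae_eq
    have h3 := ae_all_iff.2 fun i => (hdP i).weakPartialDeriv_ae_eq
    filter_upwards [h1, h2, h3] with x h1 h2 h3
    rw [← ofReal_norm, ← ofReal_norm, PiLp.norm_eq_of_L2, PiLp.norm_eq_of_L2]
    congr 3 with i
    rw [norm_gaugeField_component, h3 i]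
    change ‖weakPartialDeriv i g x‖ ^ 2 = ‖weakPartialDeriv i f x + c • (dP i x (f x) +
      projField G x (weakPartialDeriv i f x))‖ ^ 2
    rw [h1 i, h2 i]
  have hint := lintegral_congr_ae (hnorm.mono fun x hx => congrArg (· ^ 2) hx)
  rw [← hint, dirichletForm]
  split_ifs with hmem
  · rfl
  -- Off `H¹` the form is `∞`; a finite integral would make the derivatives in `hder` square
  -- integrable, forcing `g` into `H¹`.
  · by_contra hne
    exact hmem (memH1_of_lintegral_weakGradient_ne_top (Lp.memLp g) (fun i => ⟨_, hder i⟩)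
      (Ne.symm hne))
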